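/- Setting. Let $d,K,T$ be fixed. Agent $i=1,2,\dots$ in period $t=1,\dots,T$ chooses among options $k=0,\dots,K$. Here $X_{it}=(X_{it}^1,\dots,X_{it}^K)$ with $X_{it}^k\in\mathbb R^{d}$, $A_i=(A_i^1,\dots,A_i^K)$ and $\epsilon_{it}=(\epsilon_{it}^1,\dots,\epsilon_{it}^K)$ are random vectors, $X_{it}^0=0$, $A_i^0=\epsilon_{it}^0=0$, and $\beta\in\mathbb R^d$ with $\|\beta\|=1$. The choice indicators are $$Y_{it}^k=1\{\beta'X_{it}^k+A_i^k+\epsilon_{it}^k\ge \beta'X_{it}^{k'}+A_i^{k'}+\epsilon_{it}^{k'}\ \text{ for all } k'=0,\dots,K\},\qquad Y_{it}=(Y_{it}^1,\dots,Y_{it}^K).$$ The vectors $(A_i,X_{i1},\dots,X_{iT},\epsilon_{i1},\dots,\epsilon_{iT})$ are i.i.d. across $i$, and the distribution of $(A_i,X_{it},\epsilon_{it})$ does not depend on $t$. Write $x\,p=\sum_{k=1}^K p^k x^k\in\mathbb R^d$ for $x=(x^1,\dots,x^K)$ and $p\in\mathbb R^K$. For periods $s,t$ let $\mathcal G_{s,t}$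 be the support of $$(X_{is}-X_{it})\,E[Y_{is}\mid X_{is},X_{it}]+(X_{it}-X_{is})\,E[Y_{it}\mid X_{is},X_{it}],$$ let $\mathcal G_2=\bigcup_{s,t}\mathcal G_{s,t}$, and let $cc(\mathcal G_2)$ be the closed convex cone generated by $\mathcal G_2$. For $s<t$ and $j\in\{s,t\}$ let $p_{j|s,t}(x_s,x_t)$ be a version of $E[Y_{ij}\mid X_{is}=x_s,X_{it}=x_t]$, and let $\hat p_{j|s,t}$ be estimators of it, depending on the sample size $n$. Theorem 4.1 (Consistency). Suppose that, for all $t$ (and all $s<t$ in (v)): (i) $\epsilon_{it}$ is independent of $X_{it}$ given $A_i$; (ii) $E[Y_{it}\mid X_{i1},\dots,X_{iT},A_i]=E[Y_{it}\mid X_{it},A_i]$ almost surely; (iii) almost surely, for all $0\le k<k'\le K$, the conditional c.d.f. of $\epsilon_{it}^k-\epsilon_{it}^{k'}$ given $A_i$ is continuous everywhere; (iv) $cc(\mathcal G_2)$ is a half-space $\{g\in\mathbb R^d: c'g\ge 0\}$ for some $c\ne0$; (v) $\sup_{x_s\in\operatorname{supp}X_{is},\,x_t\in\operatorname{supp}X_{it}}\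 \max_{j\in\{s,t\}}\|\hat p_{j|s,t}(x_s,x_t)-p_{j|s,t}(x_s,x_t)\|\to_p 0$ as $n\to\infty$; (vi) $E\|X_{it}\|<\infty$. With $[x]_-=|\min\{x,0\}|$, let $$Q_n(b)=\max_{1\le s<t\le T}\ \frac1n\sum_{i=1}^n\Big[\sum_{k=1}^K\big(b'X_{is}^k-b'X_{it}^k\big)\big(\hat p^k_{s|s,t}(X_{is},X_{it})-\hat p^k_{t|s,t}(X_{is},X_{it})\big)\Big]_-,$$ let $\tilde\beta$ be any minimizer of $Q_n$ over $\{b\in\mathbb R^d:\max_{1\le j\le d}|b_j|=1\}$, and let $\hat\beta=\tilde\beta/\|\tilde\beta\|$. Then $\hat\beta\to_p\beta$ as $n\to\infty$. (Where a quantity is not measurable, convergence in probability is understood with the outer measure.) -/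

import Mathlib

open MeasureTheory ProbabilityTheory Filter Topology
open scoped ENNReal RealInnerProductSpace

noncomputable section

namespace PanelChoice

/-- The coefficient space `ℝ^d` with its Euclidean norm. -/
abbrev Coef (d : ℕ) : Type := EuclideanSpace ℝ (Fin d)

/-- A `d × K` covariate matrix, stored as its columns `x^1, …, x^K`. -/
abbrev Cov (d K : ℕ) : Type := Fin K → EuclideanSpace ℝ (Fin d)

/-- Extends `(v^1, …, v^K)` by the normalized value `v^0 = 0` of the outside option; the option
`k ≥ 1` of `Fin K` becomes `k.succ`. -/
def withOutside {K : ℕ} (v : Fin K → ℝ) : Fin (K + 1) → ℝ := Fin.cons 0 v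

/-- Utilities of the options `0, …, K`: `β'x^k + a^k + e^k` for `k ≥ 1`, and `0` for `k = 0`. -/
def utility {d K : ℕ} (β : Coef d) (x : Cov d K) (a e : Fin K → ℝ) : Fin (K + 1) → ℝ :=
  withOutside fun k => ⟪β, x k⟫ + a k + e k

open Classical in
/-- The vector of choice indicators: `Y^k = 1` if option `k` has the highest utility among
`0, …, K`, and `Y^k = 0` otherwise. -/
def choice {d K : ℕ} (β : Coef d) (x : Cov d K) (a e : Fin K → ℝ) : Fin K → ℝ :=
  fun k => if ∀ l, utility β x a e l ≤ utility β x a e k.succ then 1 else 0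

section OneAgent

variable {Ω : Type*} [MeasurableSpace Ω]

/-- Conditional independence of `f` and `g` given `h`, for an arbitrary probability space. -/
def CondIndepGiven {α γ δ : Type*} [MeasurableSpace α] [MeasurableSpace γ]
    [hδ : MeasurableSpace δ] (P : Measure Ω) (f : Ω → α) (g : Ω → γ) (h : Ω → δ) : Prop :=
  ∀ (u : Set α) (v : Set γ), MeasurableSet u → MeasurableSet v →
    P⟦f ⁻¹' u ∩ g ⁻¹' v | hδ.comap h⟧ =ᵐ[P]
      fun ω => (P⟦f ⁻¹' u | hδ.comap h⟧) ω * (P⟦g ⁻¹' v | hδ.comap h⟧) ω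

/-- The assumptions on the errors of an agent with fixed effects `A`, covariates `X t` and errors
`ε t`, for `t = 1, …, T`. -/
structure ErrorAssumption {d K T : ℕ} (P : Measure Ω) [IsFiniteMeasure P] (β : Coef d)
    (A : Ω → Fin K → ℝ) (X : Fin T → Ω → Cov d K) (ε : Fin T → Ω → Fin K → ℝ) : Prop where
  /-- `ε_t` is independent of `X_t` given `A`. -/
  indep : ∀ t, CondIndepGiven P (ε t) (X t) A
  /-- `E[Y_t | X_1, …, X_T, A] = E[Y_t | X_t, A]`. -/
  exogenous : ∀ t k,
    P[fun ω => choice β (X t ω) (A ω) (ε t ω) k |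
        MeasurableSpace.comap (fun ω => ((fun r => X r ω), A ω)) inferInstance] =ᵐ[P]
      P[fun ω => choice β (X t ω) (A ω) (ε t ω) k |
        MeasurableSpace.comap (fun ω => (X t ω, A ω)) inferInstance]
  /-- Continuity of the error distribution given `A`: the conditional c.d.f. of `ε_t^k - ε_t^l` is
  continuous everywhere for any two options `k ≠ l` in `0, …, K`, where `ε_t^0 = 0`. (With `l = 0`
  this says that every `ε_t^k`, equivalently the vector `ε_t`, has a continuous c.d.f.; with
  `l ≠ 0` it also excludes ties between two inside options.) -/
  continuous_cdf : ∀ t, ∀ᵐ a ∂(P.map A), ∀ k l : Fin (K + 1), k ≠ l →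
    Continuous (cdf ((condDistrib (ε t) A P a).map
      fun e => withOutside e k - withOutside e l))

/-- The σ-algebra generated by `(X_s, X_t)`. -/
abbrev sigmaPair {d K T : ℕ} (X : Fin T → Ω → Cov d K) (s t : Fin T) : MeasurableSpace Ω :=
  MeasurableSpace.comap (fun ω => (X s ω, X t ω)) inferInstance

/-- The random vector of the length-two cycle `s, t, s`:
`(X_s - X_t) E[Y_s | X_s, X_t] + (X_t - X_s) E[Y_t | X_s, X_t]`, where `Y_t` is the vector of
choice indicators. -/
def cycleVector {d K T : ℕ} (P : Measure Ω) (X : Fin T → Ω → Cov d K)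
    (Y : Fin T → Ω → Fin K → ℝ) (s t : Fin T) (ω : Ω) : Coef d :=
  ∑ k, ((P[fun ω' => Y s ω' k | sigmaPair X s t]) ω • (X s ω k - X t ω k)
    + (P[fun ω' => Y t ω' k | sigmaPair X s t]) ω • (X t ω k - X s ω k))

/-- The union, over all pairs of periods, of the supports of the length-two cycle vectors. -/
def cycleSet {d K T : ℕ} (P : Measure Ω) (X : Fin T → Ω → Cov d K)
    (Y : Fin T → Ω → Fin K → ℝ) : Set (Coef d) :=
  ⋃ (s : Fin T) (t : Fin T), (P.map (cycleVector P X Y s t)).support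

/-- `p s t j x_s x_t` is a (measurable) version of the conditional choice probability vector
`E[Y_j | X_s = x_s, X_t = x_t]`, for all `s < t` and `j ∈ {s, t}`. -/
def IsChoiceProb {d K T : ℕ} (P : Measure Ω) (X : Fin T → Ω → Cov d K)
    (Y : Fin T → Ω → Fin K → ℝ)
    (p : Fin T → Fin T → Fin T → Cov d K → Cov d K → Fin K → ℝ) : Prop :=
  ∀ s t, s < t → ∀ j, (j = s ∨ j = t) →
    Measurable (fun x : Cov d K × Cov d K => p s t j x.1 x.2) ∧
    ∀ k, (fun ω => p s t j (X s ω) (X t ω) k) =ᵐ[P] P[fun ω => Y j ω k | sigmaPair X s t]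

/-- Uniform consistency of the estimators `phat n` for `p`: for all `s < t` and `j ∈ {s, t}`, the
supremum over the supports of the covariates of `‖phat n - p‖` tends to `0` in probability.
(`P` acts as an outer measure where the supremum is not measurable; the choice of the norm on
`ℝ^K` is immaterial.) -/
def UniformlyConsistent {d K T : ℕ} (P : Measure Ω) (X : Fin T → Ω → Cov d K)
    (p : Fin T → Fin T → Fin T → Cov d K → Cov d K → Fin K → ℝ)
    (phat : ℕ → Ω → Fin T → Fin T → Fin T → Cov d K → Cov d K → Fin K → ℝ) : Prop :=
  ∀ s t, s < t → ∀ j, (j = s ∨ j = t) → ∀ δ : ℝ≥0∞, 0 < δ →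
    Tendsto (fun n => P {ω | δ ≤ ⨆ (x ∈ (P.map (X s)).support) (y ∈ (P.map (X t)).support),
      ‖phat n ω s t j x y - p s t j x y‖ₑ}) atTop (𝓝 0)

end OneAgent

/-- The closed convex cone generated by a set. -/
def cc {d : ℕ} (G : Set (Coef d)) : Set (Coef d) :=
  closure (PointedCone.hull ℝ G : Set (Coef d))

/-- A half-space with the origin on its boundary (a closed cone that is a half-space is one). -/
def IsHalfSpace {d : ℕ} (S : Set (Coef d)) : Prop :=
  ∃ c : Coef d, c ≠ 0 ∧ S = {g | 0 ≤ ⟪c, g⟫}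

section Sample

variable {Ω : Type*} [MeasurableSpace Ω]

/-- The panel `(A_i, X_{i1}, …, X_{iT}, ε_{i1}, …, ε_{iT})` is i.i.d. across the agents `i` and
stationary across `t`. Of stationarity only this is required: the joint distribution of
`(A_i, X_{it}, ε_{it})` does not depend on `t`. -/
structure IsPanel {d K T : ℕ} (P : Measure Ω) (A : ℕ → Ω → Fin K → ℝ)
    (X : ℕ → Fin T → Ω → Cov d K) (ε : ℕ → Fin T → Ω → Fin K → ℝ) : Prop where
  measurable_A : ∀ i, Measurable (A i)
  measurable_X : ∀ i t, Measurable (X i t)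
  measurable_ε : ∀ i t, Measurable (ε i t)
  indep : iIndepFun (fun i ω => (A i ω, (fun t => X i t ω), (fun t => ε i t ω))) P
  ident : ∀ i, IdentDistrib (fun ω => (A i ω, (fun t => X i t ω), (fun t => ε i t ω)))
    (fun ω => (A 0 ω, (fun t => X 0 t ω), (fun t => ε 0 t ω))) P P
  stationary : ∀ i s t, IdentDistrib (fun ω => (A i ω, X i s ω, ε i s ω))
    (fun ω => (A i ω, X i t ω, ε i t ω)) P P

/-- The negative part `[x]_- = |min {x, 0}|`. -/
def negPart (x : ℝ) : ℝ := |min x 0|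

/-- The sample criterion
`max_{s < t} n⁻¹ ∑_{i < n} [(b'X_{is} - b'X_{it})(phat_{s|s,t} - phat_{t|s,t})]_-`, with the
estimates evaluated at `(X_{is}, X_{it})`. -/
def criterion {d K T : ℕ} (X : ℕ → Fin T → Ω → Cov d K)
    (phat : ℕ → Ω → Fin T → Fin T → Fin T → Cov d K → Cov d K → Fin K → ℝ)
    (n : ℕ) (ω : Ω) (b : Coef d) : ℝ :=
  ⨆ q : {q : Fin T × Fin T // q.1 < q.2},
    (n : ℝ)⁻¹ * ∑ i ∈ Finset.range n,
      negPart (∑ k, (⟪b, X i q.1.1 ω k⟫ - ⟪b, X i q.1.2 ω k⟫) *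
        (phat n ω q.1.1 q.1.2 q.1.1 (X i q.1.1 ω) (X i q.1.2 ω) k
          - phat n ω q.1.1 q.1.2 q.1.2 (X i q.1.1 ω) (X i q.1.2 ω) k))

/-- The constraint set `{b : max_j |b_j| = 1}`. -/
def maxSphere (d : ℕ) : Set (Coef d) := {b | ⨆ j, |b j| = 1}

end Sample

end PanelChoice

end

/-! Without ties the chosen option is the unique utility maximizer, and comparing the maximizers at
two covariate values makes the change in `β`-utility, paired with the change in choices, nonnegative
(`choice_monotone`). Given the fixed effects, the errors have the same law in both periods,
independent of the covariates, so the inequality survives averaging over errors and conditioning on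
the two covariates (`inner_cycleVector_nonneg`). Thus `β` is nonnegative on every cycle support. A
half-space has only one inward normal direction, so a nonzero `b` that is not a positive multiple of
`β` is negative at some support point, hence on an event of positive probability
(`exists_inner_cycleVector_neg`).

For such a `b` on the constraint sphere, some pair of periods has expected negative part `η > 0`.
The law of large numbers at the single point `b`, with the Lipschitz dependence on the coefficient,
keeps the sample criterion large on a whole ball around `b`, while at a feasible multiple of `β` it
consists of estimation error only. With probability tending to one no minimizer lies in that ball
(`exists_nhds_negligible`). Compactness of the sphere reduces the theorem to finitely many
neighbourhoods, so no uniform law of large numbers is needed. -/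

namespace PanelChoice

/-! ### Cyclic monotonicity of choices for fixed covariates -/

section Choice

variable {d K : ℕ}

/-- A unique maximizer makes the choice vector a unit vector, or zero for the outside option, so
pairing with `c` reads off one entry. -/
lemma exists_choice_eq (β : Coef d) (x : Cov d K) (a e : Fin K → ℝ)
    (hinj : Function.Injective (utility β x a e)) :
    ∃ i : Fin (K + 1), (∀ l, utility β x a e l ≤ utility β x a e i) ∧
      ∀ c : Fin K → ℝ, ∑ k, c k * choice β x a e k = withOutside c i := by
  obtain ⟨i, hi⟩ := Finite.exists_max (utility β x a e)
  refine ⟨i, hi, fun c => ?_⟩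
  have h : ∀ k : Fin K, choice β x a e k = if k.succ = i then 1 else 0 := by
    intro k
    unfold choice
    refine if_congr ⟨fun h => hinj (le_antisymm (hi _) (h i)), ?_⟩ rfl rfl
    rintro rfl
    exact hi
  simp only [h]
  cases i using Fin.cases with
  | zero => simp [withOutside, Fin.succ_ne_zero]
  | succ j => simp [withOutside]

/-- Without ties, the choice indicators are cyclically monotone along cycles of length two. -/
lemma choice_monotone (β : Coef d) (x x' : Cov d K) (a e : Fin K → ℝ)
    (hx : Function.Injective (utility β x a e)) (hx' : Function.Injective (utility β x' a e)) :
    0 ≤ ∑ k, (⟪β, x k⟫ - ⟪β, x' k⟫) * (choice β x a e k - choice β x' a e k) := by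
  obtain ⟨i, hi, hc⟩ := exists_choice_eq β x a e hx
  obtain ⟨j, hj, hc'⟩ := exists_choice_eq β x' a e hx'
  have hw : ∀ l, withOutside (fun k => ⟪β, x k⟫ - ⟪β, x' k⟫) l
      = utility β x a e l - utility β x' a e l := by
    intro l
    cases l using Fin.cases with
    | zero => simp [utility, withOutside]
    | succ l => simp [utility, withOutside]
  simp only [mul_sub, Finset.sum_sub_distrib, hc, hc', hw]
  -- With `u`, `u'` the utilities at `x`, `x'`, the sum equals `(u i - u j) + (u' j - u' i)`, and
  -- both brackets are nonnegative by maximality.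
  linarith [hi j, hj i]

lemma measurable_utility {α : Type*} [MeasurableSpace α] (β : Coef d) {x : α → Cov d K}
    {a e : α → Fin K → ℝ} (hx : Measurable x) (ha : Measurable a) (he : Measurable e)
    (l : Fin (K + 1)) : Measurable fun z => utility β (x z) (a z) (e z) l := by
  cases l using Fin.cases with
  | zero => simp [utility, withOutside]
  | succ l =>
    simp only [utility, withOutside, Fin.cons_succ]
    fun_prop

lemma measurable_choice {α : Type*} [MeasurableSpace α] (β : Coef d) {x : α → Cov d K}
    {a e : α → Fin K → ℝ} (hx : Measurable x) (ha : Measurable a) (he : Measurable e)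
    (k : Fin K) : Measurable fun z => choice β (x z) (a z) (e z) k := by
  unfold choice
  refine Measurable.ite ?_ measurable_const measurable_const
  simp only [Set.ofPred_forall]
  exact MeasurableSet.iInter fun l =>
    measurableSet_le (measurable_utility β hx ha he l) (measurable_utility β hx ha he k.succ)

lemma choice_mem_Icc (β : Coef d) (x : Cov d K) (a e : Fin K → ℝ) (k : Fin K) :
    choice β x a e k ∈ Set.Icc (0 : ℝ) 1 := by
  unfold choice
  split_ifs <;> simp

lemma norm_choice_le (β : Coef d) (x : Cov d K) (a e : Fin K → ℝ) (k : Fin K) :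
    ‖choice β x a e k‖ ≤ 1 := by
  have := choice_mem_Icc β x a e k
  rw [Real.norm_of_nonneg this.1]
  exact this.2

lemma measure_singleton_eq_zero_of_continuous_cdf (μ : Measure ℝ) [IsProbabilityMeasure μ]
    (h : Continuous (cdf μ)) (r : ℝ) : μ {r} = 0 := by
  rw [← measure_cdf μ, StieltjesFunction.measure_singleton,
    h.continuousAt.continuousWithinAt.leftLim_eq]
  simp

lemma measurable_withOutside (l : Fin (K + 1)) :
    Measurable (fun e : Fin K → ℝ => withOutside e l) := by
  cases l using Fin.cases with
  | zero => simp [withOutside]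
  | succ l => simpa [withOutside] using measurable_pi_apply l

/-- Ties have probability zero when the differences of the errors have continuous c.d.f.s. -/
lemma ae_injective_utility (μ : Measure (Fin K → ℝ)) [IsProbabilityMeasure μ]
    (h : ∀ k l : Fin (K + 1), k ≠ l →
      Continuous (cdf (μ.map fun e => withOutside e k - withOutside e l)))
    (β : Coef d) (x : Cov d K) (a : Fin K → ℝ) :
    ∀ᵐ e ∂μ, Function.Injective (utility β x a e) := by
  have hne : ∀ k l : Fin (K + 1), k ≠ l → ∀ᵐ e ∂μ, utility β x a e k ≠ utility β x a e l := by
    intro k l hkl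
    have hm : Measurable (fun e : Fin K → ℝ => withOutside e k - withOutside e l) :=
      (measurable_withOutside k).sub (measurable_withOutside l)
    have : IsProbabilityMeasure (μ.map fun e => withOutside e k - withOutside e l) :=
      Measure.isProbabilityMeasure_map hm.aemeasurable
    have hu : ∀ e (i : Fin (K + 1)), utility β x a e i = utility β x a 0 i + withOutside e i := by
      intro e i
      cases i using Fin.cases with
      | zero => simp [utility, withOutside]
      | succ i => simp [utility, withOutside]
    have h0 := measure_singleton_eq_zero_of_continuous_cdf _ (h k l hkl)
      (utility β x a 0 l - utility β x a 0 k)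
    rw [Measure.map_apply hm (measurableSet_singleton _)] at h0
    rw [ae_iff]
    -- For fixed `x` and `a`, a tie pins the error difference to one number, an atom excluded by
    -- continuity of the c.d.f.
    refine measure_mono_null (fun e he => ?_) h0
    simp only [ne_eq, not_not, Set.mem_ofPred_eq] at he
    rw [hu e k, hu e l] at he
    simp only [Set.mem_preimage, Set.mem_singleton_iff]
    linarith
  have hall : ∀ᵐ e ∂μ, ∀ k l : Fin (K + 1), k ≠ l → utility β x a e k ≠ utility β x a e l := by
    simp only [ae_all_iff]
    exact hne
  filter_upwards [hall] with e he k l hkl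
  by_contra hc
  exact he k l hc hkl

/-- The probability of choosing option `k` when the errors have distribution `μ`. -/
noncomputable def choiceProb (β : Coef d) (μ : Measure (Fin K → ℝ)) (x : Cov d K) (a : Fin K → ℝ)
    (k : Fin K) : ℝ := ∫ e, choice β x a e k ∂μ

lemma integrable_choice (β : Coef d) (μ : Measure (Fin K → ℝ)) [IsFiniteMeasure μ]
    (x : Cov d K) (a : Fin K → ℝ) (k : Fin K) : Integrable (fun e => choice β x a e k) μ := by
  exact Integrable.of_bound
    (measurable_choice β measurable_const measurable_const measurable_id k).aestronglyMeasurable 1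
    (ae_of_all _ fun e => norm_choice_le β x a e k)

/-- Integrates `choice_monotone` over a common error draw. It is essential that the same `μ` serves
both covariate values. -/
lemma choiceProb_monotone (β : Coef d) (μ : Measure (Fin K → ℝ)) [IsProbabilityMeasure μ]
    (h : ∀ k l : Fin (K + 1), k ≠ l →
      Continuous (cdf (μ.map fun e => withOutside e k - withOutside e l)))
    (x x' : Cov d K) (a : Fin K → ℝ) :
    0 ≤ ∑ k, (⟪β, x k⟫ - ⟪β, x' k⟫) * (choiceProb β μ x a k - choiceProb β μ x' a k) := by
  have hint := fun y k => integrable_choice β μ y a k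
  simp only [choiceProb, ← integral_sub (hint _ _) (hint _ _), ← integral_const_mul]
  have hi : ∀ k ∈ Finset.univ, Integrable (fun e => (⟪β, x k⟫ - ⟪β, x' k⟫) *
      (choice β x a e k - choice β x' a e k)) μ :=
    fun k _ => ((hint x k).sub (hint x' k)).const_mul _
  rw [← integral_finsetSum _ hi]
  refine integral_nonneg_of_ae ?_
  filter_upwards [ae_injective_utility μ h β x a, ae_injective_utility μ h β x' a] with e h1 h2
  exact choice_monotone β x x' a e h1 h2

end Choice

/-! ### Conditional independence in terms of conditional distributions -/

section CondDistrib

variable {Ω : Type*} [mΩ : MeasurableSpace Ω] {α γ δ : Type*} [MeasurableSpace α]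
  [StandardBorelSpace α] [Nonempty α] [MeasurableSpace γ] [MeasurableSpace δ]

/-- By uniqueness of disintegration, it suffices that the kernel `κ`, which ignores `g`, reproduces
the joint law of `((g, h), f)`; this is checked on measurable rectangles. -/
lemma CondIndepGiven.condDistrib_prodMk_ae_eq {P : Measure Ω} [IsProbabilityMeasure P]
    {f : Ω → α} {g : Ω → γ} {h : Ω → δ} (hf : Measurable f) (hg : Measurable g)
    (hh : Measurable h) (hind : CondIndepGiven P f g h) :
    ∀ᵐ ω ∂P, condDistrib f (fun ω => (g ω, h ω)) P (g ω, h ω) = condDistrib f h P (h ω) := by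
  set κ := condDistrib f h P with hκ
  have hgh : Measurable fun ω => (g ω, h ω) := hg.prodMk hh
  have hle : MeasurableSpace.comap h inferInstance ≤ mΩ := hh.comap_le
  have key : P.map (fun ω => ((g ω, h ω), f ω))
      = P.map (fun ω => (g ω, h ω)) ⊗ₘ (κ.comap Prod.snd measurable_snd) := by
    have hM : Measurable fun ω => ((g ω, h ω), f ω) := hgh.prodMk hf
    have : IsProbabilityMeasure (P.map fun ω => ((g ω, h ω), f ω)) :=
      Measure.isProbabilityMeasure_map hM.aemeasurable
    have : IsProbabilityMeasure (P.map fun ω => (g ω, h ω)) :=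
      Measure.isProbabilityMeasure_map hgh.aemeasurable
    refine Measure.ext_prod₃' fun {v w u} hv hw hu => ?_
    rw [Measure.map_apply hM ((hv.prod hw).prod hu), Measure.compProd_apply_prod (hv.prod hw) hu,
      setLIntegral_map (hv.prod hw) (Kernel.measurable_coe _ hu) hgh]
    simp only [Kernel.comap_apply]
    have hu' : MeasurableSet (f ⁻¹' u) := hf hu
    have hv' : MeasurableSet (g ⁻¹' v) := hg hv
    have hw' : MeasurableSet (h ⁻¹' w) := hh hw
    have hwc : MeasurableSet[MeasurableSpace.comap h inferInstance] (h ⁻¹' w) := ⟨w, hw, rfl⟩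
    have hG : Measurable fun ω => (κ (h ω)).real u :=
      ((Kernel.measurable_coe κ hu).comp hh).ennreal_toReal
    have hGm : StronglyMeasurable[MeasurableSpace.comap h inferInstance]
        fun ω => (κ (h ω)).real u :=
      (((Kernel.measurable_coe κ hu).ennreal_toReal).comp
        (comap_measurable h)).stronglyMeasurable
    have hGb : ∀ ω, ‖(κ (h ω)).real u‖ ≤ 1 := fun ω => by
      rw [Real.norm_of_nonneg measureReal_nonneg]
      exact measureReal_le_one
    have hone : ∀ s : Set Ω, MeasurableSet s → Integrable (s.indicator fun _ => (1 : ℝ)) P :=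
      fun s hs => (integrable_const _).indicator hs
    have hGv : Integrable ((fun ω => (κ (h ω)).real u) *
        (g ⁻¹' v).indicator fun _ => (1 : ℝ)) P :=
      (hone _ hv').bdd_mul hG.aestronglyMeasurable (ae_of_all _ hGb)
    -- Conditional independence factors the conditional probability given `h`; the factor for `f` is
    -- a function of `h`, so it moves inside the conditional expectation, which integration over `h
    -- ⁻¹' w` then removes.
    have hreal : P.real (h ⁻¹' w ∩ (f ⁻¹' u ∩ g ⁻¹' v))
        = ∫ ω in h ⁻¹' w ∩ g ⁻¹' v, (κ (h ω)).real u ∂P := by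
      calc P.real (h ⁻¹' w ∩ (f ⁻¹' u ∩ g ⁻¹' v))
          = ∫ ω in h ⁻¹' w, (f ⁻¹' u ∩ g ⁻¹' v).indicator (fun _ => (1 : ℝ)) ω ∂P := by
            rw [setIntegral_indicator (hu'.inter hv')]
            simp
        _ = ∫ ω in h ⁻¹' w, (P⟦f ⁻¹' u ∩ g ⁻¹' v | MeasurableSpace.comap h inferInstance⟧) ω ∂P :=
            (setIntegral_condExp hle (hone _ (hu'.inter hv')) hwc).symm
        _ = ∫ ω in h ⁻¹' w, (P[(fun ω => (κ (h ω)).real u) *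
              (g ⁻¹' v).indicator (fun _ => (1 : ℝ)) | MeasurableSpace.comap h inferInstance])
              ω ∂P := by
            refine integral_congr_ae (ae_restrict_of_ae ?_)
            filter_upwards [hind u v hu hv, condDistrib_ae_eq_condExp hh hf hu (μ := P),
              condExp_mul_of_stronglyMeasurable_left hGm hGv (hone _ hv')] with ω h1 h2 h3
            rw [h1, h3, ← h2]
            rfl
        _ = ∫ ω in h ⁻¹' w, ((fun ω => (κ (h ω)).real u) *
              (g ⁻¹' v).indicator (fun _ => (1 : ℝ))) ω ∂P :=
            setIntegral_condExp hle hGv hwc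
        _ = ∫ ω in h ⁻¹' w, (g ⁻¹' v).indicator (fun ω => (κ (h ω)).real u) ω ∂P := by
            congr 1 with ω
            by_cases hω : ω ∈ g ⁻¹' v <;> simp [hω]
        _ = _ := setIntegral_indicator hv'
    have hset : (fun ω => ((g ω, h ω), f ω)) ⁻¹' ((v ×ˢ w) ×ˢ u)
        = h ⁻¹' w ∩ (f ⁻¹' u ∩ g ⁻¹' v) := by
      ext ω; simp; tauto
    have hset' : (fun ω => (g ω, h ω)) ⁻¹' (v ×ˢ w) = h ⁻¹' w ∩ g ⁻¹' v := by
      ext ω; simp; tauto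
    rw [hset, hset', ← ENNReal.ofReal_toReal (measure_ne_top P (h ⁻¹' w ∩ _)), ← measureReal_def,
      hreal, ofReal_integral_eq_lintegral_ofReal
        (Integrable.of_bound hG.aestronglyMeasurable 1 (ae_of_all _ hGb))
        (ae_of_all _ fun ω => measureReal_nonneg)]
    simp [measureReal_def]
  have h1 := condDistrib_ae_eq_of_measure_eq_compProd (fun ω => (g ω, h ω)) hf.aemeasurable key
  exact ae_of_ae_map hgh.aemeasurable h1

end CondDistrib

lemma sigmaPair_comm {Ω : Type*} {d K T : ℕ} (X : Fin T → Ω → Cov d K) (s t : Fin T) :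
    sigmaPair X s t = sigmaPair X t s := by
  have h : ∀ s t, sigmaPair X s t ≤ sigmaPair X t s := fun s t => by
    rw [sigmaPair, ← measurable_iff_comap_le]
    have h : Measurable[sigmaPair X t s] fun ω => (X t ω, X s ω) := comap_measurable _
    exact h.snd.prodMk h.fst
  exact le_antisymm (h s t) (h t s)

/-! ### Cyclic monotonicity of conditional choice probabilities -/

section Cycle

variable {Ω : Type*} [mΩ : MeasurableSpace Ω] {d K T : ℕ} {P : Measure Ω}

lemma condExp_choice_ae_eq [IsProbabilityMeasure P] (β : Coef d)
    {A ε : Ω → Fin K → ℝ} {X : Ω → Cov d K}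
    (hA : Measurable A) (hX : Measurable X) (hε : Measurable ε) (hind : CondIndepGiven P ε X A)
    (k : Fin K) :
    P[fun ω => choice β (X ω) (A ω) (ε ω) k |
        MeasurableSpace.comap (fun ω => (X ω, A ω)) inferInstance] =ᵐ[P]
      fun ω => choiceProb β (condDistrib ε A P (A ω)) (X ω) (A ω) k := by
  have hf : Measurable fun z : (Cov d K × (Fin K → ℝ)) × (Fin K → ℝ) =>
      choice β z.1.1 z.1.2 z.2 k :=
    measurable_choice β measurable_fst.fst measurable_fst.snd measurable_snd k
  have hint : Integrable (fun ω => choice β (X ω) (A ω) (ε ω) k) P :=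
    Integrable.of_bound (measurable_choice β hX hA hε k).aestronglyMeasurable 1
      (ae_of_all _ fun ω => norm_choice_le β _ _ _ k)
  have h := condExp_prod_ae_eq_integral_condDistrib (hX.prodMk hA) hε.aemeasurable
    hf.stronglyMeasurable hint
  filter_upwards [h, hind.condDistrib_prodMk_ae_eq hε hX hA] with ω h1 h2
  rw [h1, h2]
  rfl

/-- The conditional distribution is built from the joint law alone; stationarity thus gives all
periods one error kernel. -/
lemma condDistrib_eq_of_identDistrib [IsProbabilityMeasure P] {A ε ε' : Ω → Fin K → ℝ}
    (h : IdentDistrib (fun ω => (A ω, ε ω)) (fun ω => (A ω, ε' ω)) P P) :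
    condDistrib ε A P = condDistrib ε' A P := by
  rw [condDistrib_def, condDistrib_def]
  congr 1
  exact h.map_eq

/-- Condition first on all covariates and `A`, where exogeneity leaves only `(X j, A)`, then use the
tower property. -/
lemma condExp_choice_pair_ae_eq [IsProbabilityMeasure P] {β : Coef d}
    {A : Ω → Fin K → ℝ} {X : Fin T → Ω → Cov d K}
    {ε : Fin T → Ω → Fin K → ℝ} (hA : Measurable A) (hX : ∀ t, Measurable (X t))
    (hε : ∀ t, Measurable (ε t)) (herr : ErrorAssumption P β A X ε) (s t j : Fin T) (k : Fin K) :
    P[fun ω => choice β (X j ω) (A ω) (ε j ω) k | sigmaPair X s t] =ᵐ[P]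
      P[fun ω => choiceProb β (condDistrib (ε j) A P (A ω)) (X j ω) (A ω) k |
        sigmaPair X s t] := by
  have hall : Measurable fun ω => ((fun r => X r ω), A ω) := (measurable_pi_lambda _ hX).prodMk hA
  have hle : sigmaPair X s t ≤
      MeasurableSpace.comap (fun ω => ((fun r => X r ω), A ω)) inferInstance := by
    rw [sigmaPair, ← measurable_iff_comap_le]
    have h : Measurable[MeasurableSpace.comap (fun ω => ((fun r => X r ω), A ω)) inferInstance]
        fun ω => ((fun r => X r ω), A ω) := comap_measurable _
    exact ((measurable_pi_apply s).comp h.fst).prodMk ((measurable_pi_apply t).comp h.fst)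
  have h := condExp_congr_ae (m := sigmaPair X s t) ((herr.exogenous j k).trans
    (condExp_choice_ae_eq β hA (hX j) (hε j) (herr.indep j) k))
  exact (condExp_condExp_of_le hle hall.comap_le).symm.trans h

lemma inner_cycleVector (b : Coef d) (X : Fin T → Ω → Cov d K) (Y : Fin T → Ω → Fin K → ℝ)
    (s t : Fin T) (ω : Ω) :
    ⟪b, cycleVector P X Y s t ω⟫ = ∑ k, (⟪b, X s ω k⟫ - ⟪b, X t ω k⟫) *
      ((P[fun ω' => Y s ω' k | sigmaPair X s t]) ω
        - (P[fun ω' => Y t ω' k | sigmaPair X s t]) ω) := by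
  simp only [cycleVector, inner_sum, inner_add_right, inner_smul_right, inner_sub_right]
  exact Finset.sum_congr rfl fun k _ => by ring

/-- Cyclic monotonicity: the cycle vectors lie in the half-space defined by `β`. -/
lemma inner_cycleVector_nonneg [IsProbabilityMeasure P] {β : Coef d}
    {A : Ω → Fin K → ℝ} {X : Fin T → Ω → Cov d K}
    {ε Y : Fin T → Ω → Fin K → ℝ} (hA : Measurable A) (hX : ∀ t, Measurable (X t))
    (hε : ∀ t, Measurable (ε t)) (herr : ErrorAssumption P β A X ε)
    (hstat : ∀ s t, IdentDistrib (fun ω => (A ω, X s ω, ε s ω)) (fun ω => (A ω, X t ω, ε t ω)) P P)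
    (hXi : ∀ t, Integrable (X t) P)
    (hY : ∀ t ω, Y t ω = choice β (X t ω) (A ω) (ε t ω)) (s t : Fin T) :
    ∀ᵐ ω ∂P, 0 ≤ ⟪β, cycleVector P X Y s t ω⟫ := by
  simp only [inner_cycleVector, hY]
  have hκ : condDistrib (ε s) A P = condDistrib (ε t) A P :=
    condDistrib_eq_of_identDistrib
      ((hstat s t).comp (measurable_fst.prodMk measurable_snd.snd))
  set F : Fin T → Fin K → Ω → ℝ := fun j k ω =>
    choiceProb β (condDistrib (ε j) A P (A ω)) (X j ω) (A ω) k with hF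
  set D : Fin K → Ω → ℝ := fun k ω => ⟪β, X s ω k⟫ - ⟪β, X t ω k⟫ with hD
  have hFb : ∀ j k ω, ‖F j k ω‖ ≤ 1 := fun j k ω => by
    have := norm_integral_le_of_norm_le_const (μ := condDistrib (ε j) A P (A ω))
      (ae_of_all _ fun e => norm_choice_le β (X j ω) (A ω) e k)
    simpa [hF, choiceProb] using this
  have hFi : ∀ j k, Integrable (F j k) P := fun j k =>
    integrable_condExp.congr (condExp_choice_ae_eq β hA (hX j) (hε j) (herr.indep j) k)
  have hDi : ∀ k, Integrable (D k) P := fun k =>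
    (((hXi s).eval k).const_inner β).sub (((hXi t).eval k).const_inner β)
  have hDm : ∀ k, StronglyMeasurable[sigmaPair X s t] (D k) := fun k => by
    have h : Measurable[sigmaPair X s t] fun ω => (X s ω, X t ω) := comap_measurable _
    have hc : Measurable fun z : Cov d K × Cov d K => ⟪β, z.1 k⟫ - ⟪β, z.2 k⟫ := by fun_prop
    exact (hc.comp h).stronglyMeasurable
  have hFD : ∀ k, Integrable (D k * (F s k - F t k)) P := fun k =>
    (hDi k).mul_bdd (c := 2) ((hFi s k).sub (hFi t k)).aestronglyMeasurable
      (ae_of_all _ fun ω => (norm_sub_le _ _).trans (by linarith [hFb s k ω, hFb t k ω]))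
  -- The sum is nonnegative before conditioning, since by `hκ` both periods use the same error law
  -- given `A`.
  have hnn : 0 ≤ᵐ[P] P[∑ k, D k * (F s k - F t k) | sigmaPair X s t] := by
    refine condExp_nonneg ?_
    filter_upwards [ae_of_ae_map hA.aemeasurable (herr.continuous_cdf s)] with ω hω
    have := choiceProb_monotone β (condDistrib (ε s) A P (A ω)) hω (X s ω) (X t ω) (A ω)
    simpa [hF, hD, hκ] using this
  -- The utility changes `D k` are functions of `(X s, X t)` and factor out.
  have hpull : ∀ᵐ ω ∂P, ∀ k, P[D k * (F s k - F t k) | sigmaPair X s t] ω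
      = D k ω * (P[F s k | sigmaPair X s t] ω - P[F t k | sigmaPair X s t] ω) := by
    refine ae_all_iff.2 fun k => ?_
    filter_upwards [condExp_mul_of_stronglyMeasurable_left (hDm k) (hFD k)
      ((hFi s k).sub (hFi t k)), condExp_sub (hFi s k) (hFi t k) (sigmaPair X s t)] with ω h1 h2
    rw [h1, Pi.mul_apply, h2, Pi.sub_apply]
  have hE : ∀ᵐ ω ∂P, ∀ j k,
      (P[fun ω => choice β (X j ω) (A ω) (ε j ω) k | sigmaPair X s t]) ω
        = P[F j k | sigmaPair X s t] ω :=
    ae_all_iff.2 fun j => ae_all_iff.2 fun k => condExp_choice_pair_ae_eq hA hX hε herr s t j k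
  filter_upwards [hnn, condExp_finsetSum (fun k (_ : k ∈ Finset.univ) => hFD k) (sigmaPair X s t),
    hpull, hE] with ω h1 h2 h3 h4
  simp only [h4]
  rw [h2, Finset.sum_apply] at h1
  simp only [h3] at h1
  exact h1

lemma cycleVector_comm (X : Fin T → Ω → Cov d K) (Y : Fin T → Ω → Fin K → ℝ) (s t : Fin T) :
    cycleVector P X Y s t = cycleVector P X Y t s := by
  funext ω
  simp only [cycleVector, sigmaPair_comm X s t]
  exact Finset.sum_congr rfl fun k _ => add_comm _ _

lemma measurable_cycleVector {X : Fin T → Ω → Cov d K} (hX : ∀ t, Measurable (X t))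
    (Y : Fin T → Ω → Fin K → ℝ) (s t : Fin T) : Measurable (cycleVector P X Y s t) := by
  have hle : sigmaPair X s t ≤ mΩ := ((hX s).prodMk (hX t)).comap_le
  have hc : ∀ j k, Measurable (P[fun ω' => Y j ω' k | sigmaPair X s t]) := fun j k =>
    (stronglyMeasurable_condExp.mono hle).measurable
  have hXk : ∀ j k, Measurable fun ω => X j ω k := fun j k => (measurable_pi_apply k).comp (hX j)
  unfold cycleVector
  exact Finset.measurable_fun_sum _ fun k _ =>
    ((hc s k).smul ((hXk s k).sub (hXk t k))).add ((hc t k).smul ((hXk t k).sub (hXk s k)))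

end Cycle

/-! ### Half-spaces determine their normal direction -/

section Geometry

variable {d : ℕ}

lemma cc_subset_of_forall_inner_nonneg {G : Set (Coef d)} {b : Coef d}
    (h : ∀ g ∈ G, 0 ≤ ⟪b, g⟫) : ∀ g ∈ cc G, 0 ≤ ⟪b, g⟫ := by
  have hcl : IsClosed {g : Coef d | 0 ≤ ⟪b, g⟫} :=
    isClosed_le continuous_const (continuous_const.inner continuous_id)
  refine fun g hg => closure_minimal (fun x hx => ?_) hcl hg
  induction hx using Submodule.span_induction with
  | mem x hx => exact h x hx
  | zero => simp
  | add x y _ _ hx hy =>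
    simp only [Set.mem_ofPred_eq, inner_add_right] at *
    exact add_nonneg hx hy
  | smul a x _ hx =>
    simp only [Set.mem_ofPred_eq] at *
    change 0 ≤ ⟪b, (a : ℝ) • x⟫
    rw [inner_smul_right]
    exact mul_nonneg a.2 hx

/-- The part `g` of `b` orthogonal to `c` lies in the half-space together with `-g`, so `⟪b, g⟫ =
0`; as `⟪b, g⟫ = ⟪g, g⟫`, it vanishes. Testing `c` itself fixes the sign of the multiple. -/
lemma exists_eq_smul_of_halfSpace_subset {b c : Coef d} (hb : b ≠ 0) (hc : c ≠ 0)
    (h : ∀ g : Coef d, 0 ≤ ⟪c, g⟫ → 0 ≤ ⟪b, g⟫) : ∃ r : ℝ, 0 < r ∧ b = r • c := by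
  have hcc : 0 < ⟪c, c⟫ := real_inner_self_pos.2 hc
  set r := ⟪c, b⟫ / ⟪c, c⟫ with hr
  set g := b - r • c with hg
  have hcg : ⟪c, g⟫ = 0 := by
    rw [hg, inner_sub_right, inner_smul_right, hr, div_mul_cancel₀ _ hcc.ne', sub_self]
  have h1 := h g hcg.ge
  have h2 := h (-g) (by rw [inner_neg_right, hcg, neg_zero])
  rw [inner_neg_right] at h2
  have hgg : ⟪g, g⟫ = 0 := by
    conv_lhs => rw [hg]
    rw [← hg, inner_sub_left, inner_smul_left, hcg]
    simp
    linarith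
  have hbr : b = r • c := sub_eq_zero.1 (inner_self_eq_zero.1 hgg)
  have hr0 : 0 ≤ r := div_nonneg (by rw [real_inner_comm]; exact h c hcc.le) hcc.le
  refine ⟨r, hr0.lt_of_ne fun h0 => hb ?_, hbr⟩
  rw [hbr, ← h0, zero_smul]

lemma normalize_eq_of_forall_inner_nonneg {G : Set (Coef d)} (hG : IsHalfSpace (cc G))
    {b β : Coef d} (hβ : ‖β‖ = 1) (hb : b ≠ 0) (hβG : ∀ g ∈ G, 0 ≤ ⟪β, g⟫)
    (hbG : ∀ g ∈ G, 0 ≤ ⟪b, g⟫) : ‖b‖⁻¹ • b = β := by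
  obtain ⟨c, hc, hS⟩ := hG
  have hβ0 : β ≠ 0 := by rintro rfl; simp at hβ
  obtain ⟨r, hr, rfl⟩ := exists_eq_smul_of_halfSpace_subset hb hc fun g hg =>
    cc_subset_of_forall_inner_nonneg hbG g (hS ▸ hg)
  obtain ⟨q, hq, rfl⟩ := exists_eq_smul_of_halfSpace_subset hβ0 hc fun g hg =>
    cc_subset_of_forall_inner_nonneg hβG g (hS ▸ hg)
  rw [norm_smul, Real.norm_of_nonneg hq.le] at hβ
  rw [norm_smul, Real.norm_of_nonneg hr.le, smul_smul]
  congr 1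
  have hcn : ‖c‖ = q⁻¹ := eq_inv_of_mul_eq_one_right hβ
  rw [hcn]
  field_simp

end Geometry

/-! ### Identification of the direction of `β` -/

section Identification

variable {Ω : Type*} [mΩ : MeasurableSpace Ω] {d K T : ℕ} {P : Measure Ω}

/-- Identification: a coefficient that is not a positive multiple of `β` violates some cyclic
monotonicity inequality with positive probability. -/
lemma exists_inner_cycleVector_neg {β b : Coef d} (hβ : ‖β‖ = 1) {X : Fin T → Ω → Cov d K}
    {Y : Fin T → Ω → Fin K → ℝ} (hX : ∀ t, Measurable (X t))
    (hcc : IsHalfSpace (cc (cycleSet P X Y)))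
    (hnn : ∀ s t, ∀ᵐ ω ∂P, 0 ≤ ⟪β, cycleVector P X Y s t ω⟫)
    (hb : b ≠ 0) (hbβ : ‖b‖⁻¹ • b ≠ β) :
    ∃ s t, s < t ∧ 0 < P {ω | ⟪b, cycleVector P X Y s t ω⟫ < 0} := by
  have hβG : ∀ g ∈ cycleSet P X Y, 0 ≤ ⟪β, g⟫ := by
    intro g hg
    simp only [cycleSet, Set.mem_iUnion] at hg
    obtain ⟨s, t, hg⟩ := hg
    have hcl : IsClosed {g : Coef d | 0 ≤ ⟪β, g⟫} :=
      isClosed_le continuous_const (continuous_const.inner continuous_id)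
    refine Measure.support_subset_of_isClosed hcl ?_ hg
    exact (ae_map_iff (measurable_cycleVector hX Y s t).aemeasurable hcl.measurableSet).2 (hnn s t)
  have hex : ∃ g ∈ cycleSet P X Y, ⟪b, g⟫ < 0 := by
    by_contra! h
    exact hbβ (normalize_eq_of_forall_inner_nonneg hcc hβ hb hβG h)
  obtain ⟨g, hg, hneg⟩ := hex
  simp only [cycleSet, Set.mem_iUnion] at hg
  obtain ⟨s, t, hg⟩ := hg
  have hop : IsOpen {g : Coef d | ⟪b, g⟫ < 0} :=
    isOpen_lt (continuous_const.inner continuous_id) continuous_const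
  have hpos := (Measure.mem_support_iff_forall g).1 hg _ (hop.mem_nhds hneg)
  rw [Measure.map_apply (measurable_cycleVector hX Y s t) hop.measurableSet] at hpos
  -- The criterion uses ordered pairs only: reversing a cycle leaves its vector unchanged, and the
  -- cycle `s, s` has vector zero.
  rcases lt_trichotomy s t with h | rfl | h
  · exact ⟨s, t, h, hpos⟩
  · exfalso
    have h0 : cycleVector P X Y s s ⁻¹' {g : Coef d | ⟪b, g⟫ < 0} = ∅ := by
      ext ω
      simp [cycleVector]
    simp [h0] at hpos
  · exact ⟨t, s, h, by rwa [cycleVector_comm X Y s t] at hpos⟩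

end Identification

/-! ### Events of vanishing outer probability -/

section Negligible

variable {Ω : Type*} [MeasurableSpace Ω] {P : Measure Ω}

/-- The (possibly non-measurable) events `Q n` have outer probability tending to `0`. -/
def Negligible (P : Measure Ω) (Q : ℕ → Ω → Prop) : Prop :=
  Tendsto (fun n => P {ω | Q n ω}) atTop (𝓝 0)

lemma Negligible.mono {Q R : ℕ → Ω → Prop} (hR : Negligible P R) (h : ∀ n ω, Q n ω → R n ω) :
    Negligible P Q :=
  tendsto_of_tendsto_of_tendsto_of_le_of_le tendsto_const_nhds hR (fun _ => zero_le)
    fun n => measure_mono (h n)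

lemma Negligible.or {Q R : ℕ → Ω → Prop} (hQ : Negligible P Q) (hR : Negligible P R) :
    Negligible P (fun n ω => Q n ω ∨ R n ω) := by
  have h : Tendsto (fun n => P {ω | Q n ω} + P {ω | R n ω}) atTop (𝓝 0) := by
    simpa using Tendsto.add hQ hR
  exact tendsto_of_tendsto_of_tendsto_of_le_of_le tendsto_const_nhds h (fun _ => zero_le)
    fun n => measure_union_le {ω | Q n ω} {ω | R n ω}

lemma Negligible.exists {ι : Type*} [Fintype ι] {Q : ι → ℕ → Ω → Prop}
    (hQ : ∀ i, Negligible P (Q i)) : Negligible P (fun n ω => ∃ i, Q i n ω) := by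
  have h : Tendsto (fun n => ∑ i, P {ω | Q i n ω}) atTop (𝓝 0) := by
    simpa using tendsto_finsetSum Finset.univ fun i _ => hQ i
  refine tendsto_of_tendsto_of_tendsto_of_le_of_le tendsto_const_nhds h (fun _ => zero_le)
    fun n => ?_
  refine (measure_mono fun ω hω => ?_).trans (measure_iUnion_fintype_le P fun i => {ω | Q i n ω})
  exact Set.mem_iUnion.2 hω

lemma negligible_false : Negligible P (fun _ _ => False) := by simp [Negligible]

lemma Negligible.and_left {a : Prop} {Q : ℕ → Ω → Prop} (h : a → Negligible P Q) :
    Negligible P (fun n ω => a ∧ Q n ω) := by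
  by_cases ha : a
  · exact (h ha).mono fun _ _ hq => hq.2
  · exact negligible_false.mono fun _ _ hq => ha hq.1

lemma negligible_of_ae {Q : Ω → Prop} (h : ∀ᵐ ω ∂P, Q ω) : Negligible P (fun _ ω => ¬ Q ω) := by
  simp [Negligible, ae_iff.1 h]

end Negligible

/-! ### The negative part -/

section NegPart

lemma negPart_eq_neg_min (x : ℝ) : negPart x = -min x 0 := abs_of_nonpos (min_le_right _ _)

lemma negPart_nonneg (x : ℝ) : 0 ≤ negPart x := abs_nonneg _

lemma negPart_of_nonneg {x : ℝ} (h : 0 ≤ x) : negPart x = 0 := by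
  rw [negPart_eq_neg_min, min_eq_right h, neg_zero]

lemma negPart_of_neg {x : ℝ} (h : x < 0) : negPart x = -x := by
  rw [negPart_eq_neg_min, min_eq_left h.le]

lemma negPart_le_add (x y : ℝ) : negPart x ≤ negPart y + |x - y| := by
  rw [negPart_eq_neg_min, negPart_eq_neg_min]
  have h1 := neg_abs_le (x - y)
  have h2 := abs_nonneg (x - y)
  rcases min_choice x 0 with h | h <;> rw [h]
  · linarith [min_le_left y 0]
  · linarith [min_le_right y 0]

lemma continuous_negPart : Continuous negPart :=
  continuous_abs.comp (continuous_id.min continuous_const)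

end NegPart

/-! ### Cycle vectors as functions of the covariates -/

section CycleOf

variable {d K T : ℕ}

/-- The vector of the cycle `s, t, s` at the covariates `x` for choice probabilities `p`. -/
noncomputable def cycleOf (p : Fin T → Fin T → Fin T → Cov d K → Cov d K → Fin K → ℝ)
    (s t : Fin T) (x : Fin T → Cov d K) : Coef d :=
  ∑ k, (p s t s (x s) (x t) k - p s t t (x s) (x t) k) • (x s k - x t k)

/-- The total change of the covariates between two periods. -/
noncomputable def change (s t : Fin T) (x : Fin T → Cov d K) : ℝ := ∑ k, ‖x s k - x t k‖

lemma inner_cycleOf (b : Coef d) (p : Fin T → Fin T → Fin T → Cov d K → Cov d K → Fin K → ℝ)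
    (s t : Fin T) (x : Fin T → Cov d K) :
    ⟪b, cycleOf p s t x⟫ = ∑ k, (⟪b, x s k⟫ - ⟪b, x t k⟫) *
      (p s t s (x s) (x t) k - p s t t (x s) (x t) k) := by
  simp only [cycleOf, inner_sum, inner_smul_right, inner_sub_right]
  exact Finset.sum_congr rfl fun k _ => mul_comm _ _

lemma norm_cycleOf_sub_le {p q : Fin T → Fin T → Fin T → Cov d K → Cov d K → Fin K → ℝ}
    {s t : Fin T} {x : Fin T → Cov d K} {δ : ℝ}
    (h : ∀ j, (j = s ∨ j = t) → ‖q s t j (x s) (x t) - p s t j (x s) (x t)‖ ≤ δ) :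
    ‖cycleOf q s t x - cycleOf p s t x‖ ≤ 2 * δ * change s t x := by
  rw [cycleOf, cycleOf, ← Finset.sum_sub_distrib, change, Finset.mul_sum]
  refine norm_sum_le_of_le _ fun k _ => ?_
  rw [← sub_smul, norm_smul]
  refine mul_le_mul_of_nonneg_right ?_ (norm_nonneg _)
  have hs := (norm_le_pi_norm (q s t s (x s) (x t) - p s t s (x s) (x t)) k).trans (h s (.inl rfl))
  have ht := (norm_le_pi_norm (q s t t (x s) (x t) - p s t t (x s) (x t)) k).trans (h t (.inr rfl))
  rw [Pi.sub_apply] at hs ht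
  calc _ = ‖(q s t s (x s) (x t) k - p s t s (x s) (x t) k)
        - (q s t t (x s) (x t) k - p s t t (x s) (x t) k)‖ := by congr 1; ring
    _ ≤ _ := (norm_sub_le _ _).trans (by linarith)

lemma change_nonneg (s t : Fin T) (x : Fin T → Cov d K) : 0 ≤ change s t x :=
  Finset.sum_nonneg fun _ _ => norm_nonneg _

lemma measurable_change (s t : Fin T) : Measurable (change (d := d) (K := K) s t) := by
  unfold change
  fun_prop

lemma measurable_cycleOf {p : Fin T → Fin T → Fin T → Cov d K → Cov d K → Fin K → ℝ} {s t : Fin T}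
    (hp : ∀ j, (j = s ∨ j = t) → Measurable fun x : Cov d K × Cov d K => p s t j x.1 x.2) :
    Measurable (cycleOf p s t) := by
  have hpair : Measurable fun x : Fin T → Cov d K => (x s, x t) :=
    (measurable_pi_apply s).prodMk (measurable_pi_apply t)
  have h : ∀ j, (j = s ∨ j = t) → ∀ k,
      Measurable fun x : Fin T → Cov d K => p s t j (x s) (x t) k :=
    fun j hj k => (measurable_pi_apply k).comp ((hp j hj).comp hpair)
  unfold cycleOf
  refine Finset.measurable_fun_sum _ fun k _ =>
    ((h s (.inl rfl) k).sub (h t (.inr rfl) k)).smul ?_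
  fun_prop

variable {Ω : Type*} [mΩ : MeasurableSpace Ω] {P : Measure Ω}

/-- Conditional expectations live on the sample space of one agent; the version `p` turns them into
a function that can be evaluated and averaged over all agents. -/
lemma cycleOf_ae_eq_cycleVector {X : Fin T → Ω → Cov d K} {Y : Fin T → Ω → Fin K → ℝ}
    {p : Fin T → Fin T → Fin T → Cov d K → Cov d K → Fin K → ℝ} (hp : IsChoiceProb P X Y p)
    {s t : Fin T} (hst : s < t) :
    (fun ω => cycleOf p s t fun r => X r ω) =ᵐ[P] cycleVector P X Y s t := by
  have hs := ae_all_iff.2 (hp s t hst s (.inl rfl)).2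
  have ht := ae_all_iff.2 (hp s t hst t (.inr rfl)).2
  filter_upwards [hs, ht] with ω h1 h2
  simp only [cycleOf, cycleVector, h1, h2]
  refine Finset.sum_congr rfl fun k _ => ?_
  rw [← neg_sub (X s ω k) (X t ω k), smul_neg, ← sub_eq_add_neg, ← sub_smul]

lemma integrable_cycleOf [IsFiniteMeasure P] {X : Fin T → Ω → Cov d K}
    {Y : Fin T → Ω → Fin K → ℝ} {p : Fin T → Fin T → Fin T → Cov d K → Cov d K → Fin K → ℝ}
    (hp : IsChoiceProb P X Y p) (hX : ∀ t, Measurable (X t)) (hXi : ∀ t, Integrable (X t) P)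
    (hY : ∀ t k ω, |Y t ω k| ≤ 1) {s t : Fin T} (hst : s < t) :
    Integrable (fun ω => cycleOf p s t fun r => X r ω) P := by
  have hb : ∀ j, (j = s ∨ j = t) → ∀ k, ∀ᵐ ω ∂P, ‖p s t j (X s ω) (X t ω) k‖ ≤ 1 := by
    intro j hj k
    filter_upwards [(hp s t hst j hj).2 k, ae_bdd_abs_condExp_of_ae_bdd_abs (R := 1)
      (m := sigmaPair X s t) (ae_of_all P (hY j k))] with ω h1 h2
    rw [h1]
    exact h2
  have hm : ∀ j, (j = s ∨ j = t) → ∀ k, Measurable fun ω => p s t j (X s ω) (X t ω) k :=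
    fun j hj k => (measurable_pi_apply k).comp ((hp s t hst j hj).1.comp ((hX s).prodMk (hX t)))
  refine integrable_finsetSum _ fun k _ => ?_
  refine Integrable.bdd_smul (((hXi s).eval k).sub ((hXi t).eval k)) 2
    ((hm s (.inl rfl) k).sub (hm t (.inr rfl) k)).aestronglyMeasurable ?_
  filter_upwards [hb s (.inl rfl) k, hb t (.inr rfl) k] with ω h1 h2
  exact (norm_sub_le _ _).trans (by linarith)

lemma integrable_change {X : Fin T → Ω → Cov d K} (hXi : ∀ t, Integrable (X t) P) (s t : Fin T) :
    Integrable (fun ω => change s t fun r => X r ω) P :=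
  integrable_finsetSum _ fun k _ => (((hXi s).eval k).sub ((hXi t).eval k)).norm

end CycleOf

/-! ### Sample means and the law of large numbers -/

section SampleMean

variable {Ω : Type*} {d K T : ℕ}

/-- The average of `f (X_{i1}, …, X_{iT})` over the first `n` agents. -/
noncomputable def sampleMean (X : ℕ → Fin T → Ω → Cov d K) (f : (Fin T → Cov d K) → ℝ) (n : ℕ)
    (ω : Ω) : ℝ := (n : ℝ)⁻¹ * ∑ i ∈ Finset.range n, f fun t => X i t ω

lemma sampleMean_mono {X : ℕ → Fin T → Ω → Cov d K} {f g : (Fin T → Cov d K) → ℝ} {n : ℕ} {ω : Ω}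
    (h : ∀ i, f (fun t => X i t ω) ≤ g fun t => X i t ω) :
    sampleMean X f n ω ≤ sampleMean X g n ω :=
  mul_le_mul_of_nonneg_left (Finset.sum_le_sum fun i _ => h i) (by positivity)

lemma sampleMean_nonneg {X : ℕ → Fin T → Ω → Cov d K} {f : (Fin T → Cov d K) → ℝ} (h : ∀ x, 0 ≤ f x)
    (n : ℕ) (ω : Ω) : 0 ≤ sampleMean X f n ω :=
  mul_nonneg (by positivity) (Finset.sum_nonneg fun i _ => h _)

lemma sampleMean_add (X : ℕ → Fin T → Ω → Cov d K) (f g : (Fin T → Cov d K) → ℝ) (n : ℕ) (ω : Ω) :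
    sampleMean X (fun x => f x + g x) n ω = sampleMean X f n ω + sampleMean X g n ω := by
  simp only [sampleMean, Finset.sum_add_distrib, mul_add]

lemma sampleMean_const_mul (X : ℕ → Fin T → Ω → Cov d K) (c : ℝ) (f : (Fin T → Cov d K) → ℝ)
    (n : ℕ) (ω : Ω) : sampleMean X (fun x => c * f x) n ω = c * sampleMean X f n ω := by
  simp only [sampleMean, ← Finset.mul_sum]
  ring

variable [MeasurableSpace Ω] {P : Measure Ω} {A : ℕ → Ω → Fin K → ℝ} {X : ℕ → Fin T → Ω → Cov d K}
  {ε : ℕ → Fin T → Ω → Fin K → ℝ}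

lemma IsPanel.identDistrib_X (h : IsPanel P A X ε) (i : ℕ) :
    IdentDistrib (fun ω t => X i t ω) (fun ω t => X 0 t ω) P P :=
  (h.ident i).comp measurable_snd.fst

lemma IsPanel.ae_forall (h : IsPanel P A X ε) {q : (Fin T → Cov d K) → Prop}
    (hm : MeasurableSet {x | q x}) (hq : ∀ᵐ ω ∂P, q fun t => X 0 t ω) :
    ∀ᵐ ω ∂P, ∀ i, q fun t => X i t ω :=
  ae_all_iff.2 fun i => (h.identDistrib_X i).symm.ae_snd hm hq

/-- Weak law of large numbers for the covariates. -/
lemma IsPanel.negligible_sampleMean [IsFiniteMeasure P] (h : IsPanel P A X ε)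
    {f : (Fin T → Cov d K) → ℝ} (hf : Measurable f)
    (hi : Integrable (fun ω => f fun t => X 0 t ω) P) {η : ℝ} (hη : 0 < η) :
    Negligible P (fun n ω => η ≤ |sampleMean X f n ω - ∫ ω, f (fun t => X 0 t ω) ∂P|) := by
  have hX : ∀ i, Measurable fun ω => f fun t => X i t ω := fun i =>
    hf.comp (measurable_pi_lambda _ (h.measurable_X i))
  have hg : Measurable fun z : (Fin K → ℝ) × (Fin T → Cov d K) × (Fin T → Fin K → ℝ) => f z.2.1 :=
    hf.comp measurable_snd.fst
  have hind := h.indep.comp (fun _ z => f z.2.1) fun _ => hg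
  have hlln := strong_law_ae_real (fun i ω => f fun t => X i t ω) hi
    (fun i j hij => hind.indepFun hij) fun i => (h.identDistrib_X i).comp hf
  have hm : ∀ n, AEStronglyMeasurable (sampleMean X f n) P := fun n =>
    (measurable_const.mul
      (Finset.measurable_fun_sum _ fun i _ => hX i)).aestronglyMeasurable
  have ht := tendstoInMeasure_of_tendsto_ae (g := fun _ => ∫ ω, f (fun t => X 0 t ω) ∂P) hm (by
    filter_upwards [hlln] with ω hω
    simpa only [sampleMean, div_eq_inv_mul] using hω)
  have := ht (ENNReal.ofReal η) (ENNReal.ofReal_pos.2 hη)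
  simp only [edist_dist, Real.dist_eq, ENNReal.ofReal_le_ofReal_iff (abs_nonneg _)] at this
  exact this

end SampleMean

/-! ### The constraint set -/

section MaxSphere

variable {d : ℕ}

lemma iSup_abs_eq_norm (b : Coef d) : ⨆ j, |b j| = ‖WithLp.ofLp b‖ := by
  rcases isEmpty_or_nonempty (Fin d) with h | h
  -- For `d = 0` the empty supremum is `0`, matching the norm.
  · simp [Subsingleton.elim (WithLp.ofLp b) 0]
  · refine le_antisymm (ciSup_le fun j => norm_le_pi_norm (WithLp.ofLp b) j) ?_
    refine (pi_norm_le_iff_of_nonempty _).2 fun j => ?_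
    exact le_ciSup (f := fun j => |b j|) (Set.finite_range _).bddAbove j

lemma mem_maxSphere {b : Coef d} : b ∈ maxSphere d ↔ ‖WithLp.ofLp b‖ = 1 := by
  rw [← iSup_abs_eq_norm]
  rfl

lemma isCompact_maxSphere : IsCompact (maxSphere d) := by
  have h : maxSphere d = WithLp.toLp 2 '' Metric.sphere (0 : Fin d → ℝ) 1 := by
    ext b
    rw [mem_maxSphere]
    constructor
    · exact fun hb => ⟨WithLp.ofLp b, by simpa using hb, rfl⟩
    · rintro ⟨c, hc, rfl⟩
      simpa using hc
  rw [h]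
  exact (isCompact_sphere _ _).image (PiLp.continuous_toLp 2 _)

lemma ne_zero_of_mem_maxSphere {b : Coef d} (hb : b ∈ maxSphere d) : b ≠ 0 := by
  rintro rfl
  simp [mem_maxSphere] at hb

lemma exists_smul_mem_maxSphere {b : Coef d} (hb : b ≠ 0) :
    ∃ r : ℝ, 0 < r ∧ r • b ∈ maxSphere d := by
  have h : 0 < ‖WithLp.ofLp b‖ := norm_pos_iff.2 fun h => hb (by ext j; simp [h])
  refine ⟨‖WithLp.ofLp b‖⁻¹, inv_pos.2 h, ?_⟩
  rw [mem_maxSphere, WithLp.ofLp_smul, norm_smul, norm_inv, norm_norm, inv_mul_cancel₀ h.ne']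

end MaxSphere

/-! ### Deterministic bounds on the sample criterion -/

section Criterion

variable {Ω : Type*} {d K T : ℕ}

lemma criterion_eq (X : ℕ → Fin T → Ω → Cov d K)
    (phat : ℕ → Ω → Fin T → Fin T → Fin T → Cov d K → Cov d K → Fin K → ℝ) (n : ℕ) (ω : Ω)
    (b : Coef d) :
    criterion X phat n ω b = ⨆ q : {q : Fin T × Fin T // q.1 < q.2},
      sampleMean X (fun x => negPart ⟪b, cycleOf (phat n ω) q.1.1 q.1.2 x⟫) n ω := by
  simp only [criterion, sampleMean, inner_cycleOf]

lemma sampleMean_le_criterion (X : ℕ → Fin T → Ω → Cov d K)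
    (phat : ℕ → Ω → Fin T → Fin T → Fin T → Cov d K → Cov d K → Fin K → ℝ) (n : ℕ) (ω : Ω)
    (b : Coef d) {s t : Fin T} (hst : s < t) :
    sampleMean X (fun x => negPart ⟪b, cycleOf (phat n ω) s t x⟫) n ω
      ≤ criterion X phat n ω b := by
  rw [criterion_eq]
  exact le_ciSup (f := fun q : {q : Fin T × Fin T // q.1 < q.2} =>
    sampleMean X (fun x => negPart ⟪b, cycleOf (phat n ω) q.1.1 q.1.2 x⟫) n ω)
    (Set.finite_range _).bddAbove ⟨(s, t), hst⟩

lemma negPart_inner_le (b b' g g' : Coef d) :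
    negPart ⟪b, g⟫ ≤ negPart ⟪b', g'⟫ + (‖b - b'‖ * ‖g‖ + ‖b'‖ * ‖g' - g‖) := by
  refine (negPart_le_add _ ⟪b', g'⟫).trans (add_le_add_right ?_ _)
  have h : ⟪b, g⟫ - ⟪b', g'⟫ = ⟪b - b', g⟫ - ⟪b', g' - g⟫ := by
    simp only [inner_sub_left, inner_sub_right]
    ring
  rw [h]
  exact (norm_sub_le _ _).trans (add_le_add (norm_inner_le_norm (𝕜 := ℝ) _ _)
    (norm_inner_le_norm (𝕜 := ℝ) _ _))

/-- If the estimates are uniformly within `δ` of `p`, the sample criterion at `b` computed with `p`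
is controlled by that at `b'` computed with the estimates. -/
lemma sampleMean_negPart_le {X : ℕ → Fin T → Ω → Cov d K}
    {p q : Fin T → Fin T → Fin T → Cov d K → Cov d K → Fin K → ℝ} {n : ℕ} {ω : Ω} {s t : Fin T}
    {δ : ℝ} (h : ∀ i j, (j = s ∨ j = t) →
      ‖q s t j (X i s ω) (X i t ω) - p s t j (X i s ω) (X i t ω)‖ ≤ δ) (b b' : Coef d) :
    sampleMean X (fun x => negPart ⟪b, cycleOf p s t x⟫) n ω ≤
      sampleMean X (fun x => negPart ⟪b', cycleOf q s t x⟫) n ω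
        + (‖b - b'‖ * sampleMean X (fun x => ‖cycleOf p s t x‖) n ω
          + ‖b'‖ * (2 * δ) * sampleMean X (change s t) n ω) := by
  rw [← sampleMean_const_mul, ← sampleMean_const_mul, ← sampleMean_add, ← sampleMean_add]
  refine sampleMean_mono fun i => (negPart_inner_le _ b' _
    (cycleOf q s t fun t => X i t ω)).trans ?_
  rw [mul_assoc]
  gcongr
  exact norm_cycleOf_sub_le (x := fun t => X i t ω) (h i)

/-- Where `b` satisfies all sampled inequalities with the true `p`, the negative parts computed from
`p` vanish, leaving estimation error only. -/
lemma criterion_le {X : ℕ → Fin T → Ω → Cov d K}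
    {p : Fin T → Fin T → Fin T → Cov d K → Cov d K → Fin K → ℝ}
    {phat : ℕ → Ω → Fin T → Fin T → Fin T → Cov d K → Cov d K → Fin K → ℝ} {n : ℕ} {ω : Ω}
    {δ M : ℝ} (hne : ∃ s t : Fin T, s < t) (hδ : 0 ≤ δ)
    (h : ∀ s t, s < t → ∀ i j, (j = s ∨ j = t) →
      ‖phat n ω s t j (X i s ω) (X i t ω) - p s t j (X i s ω) (X i t ω)‖ ≤ δ)
    (hM : ∀ s t, sampleMean X (change s t) n ω ≤ M) {b : Coef d}
    (hb : ∀ s t, s < t → ∀ i, 0 ≤ ⟪b, cycleOf p s t fun r => X i r ω⟫) :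
    criterion X phat n ω b ≤ ‖b‖ * (2 * δ) * M := by
  obtain ⟨s, t, hst⟩ := hne
  -- Bounding the supremum termwise requires at least one pair of periods.
  have : Nonempty {q : Fin T × Fin T // q.1 < q.2} := ⟨⟨(s, t), hst⟩⟩
  rw [criterion_eq]
  refine ciSup_le fun q => ?_
  obtain ⟨⟨s, t⟩, hst⟩ := q
  calc sampleMean X (fun x => negPart ⟪b, cycleOf (phat n ω) s t x⟫) n ω
      ≤ sampleMean X (fun x => ‖b‖ * (2 * δ) * change s t x) n ω := by
        refine sampleMean_mono fun i => ?_
        have h1 := negPart_inner_le b b (cycleOf (phat n ω) s t fun r => X i r ω)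
          (cycleOf p s t fun r => X i r ω)
        rw [negPart_of_nonneg (hb s t hst i), sub_self, norm_zero, zero_mul, zero_add, zero_add,
          norm_sub_rev] at h1
        refine h1.trans ?_
        rw [mul_assoc]
        gcongr
        exact norm_cycleOf_sub_le (x := fun t => X i t ω) (h s t hst i)
    _ = ‖b‖ * (2 * δ) * sampleMean X (change s t) n ω := sampleMean_const_mul _ _ _ _ _
    _ ≤ ‖b‖ * (2 * δ) * M := by
        gcongr
        exact hM s t

end Criterion

/-! ### Excluding minimizers near wrong directions -/

section Consistency

variable {Ω : Type*} [MeasurableSpace Ω] {d K T : ℕ} {P : Measure Ω} {A : ℕ → Ω → Fin K → ℝ}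
  {X : ℕ → Fin T → Ω → Cov d K} {ε Y : ℕ → Fin T → Ω → Fin K → ℝ}
  {p : Fin T → Fin T → Fin T → Cov d K → Cov d K → Fin K → ℝ}
  {phat : ℕ → Ω → Fin T → Fin T → Fin T → Cov d K → Cov d K → Fin K → ℝ}

/-- The estimation error of the choice probabilities at the observed covariates is uniformly
small with probability approaching one. -/
lemma UniformlyConsistent.negligible (hpanel : IsPanel P A X ε)
    (h : UniformlyConsistent P (X 0) p phat) {δ : ℝ} (hδ : 0 < δ) :
    Negligible P (fun n ω => ¬ ∀ s t, s < t → ∀ i j, (j = s ∨ j = t) →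
      ‖phat n ω s t j (X i s ω) (X i t ω) - p s t j (X i s ω) (X i t ω)‖ ≤ δ) := by
  -- Almost surely all agents' covariates lie in the supports, so the supremum there dominates the
  -- errors at the observed points.
  have hsupp : ∀ᵐ ω ∂P, ∀ i t, X i t ω ∈ (P.map (X 0 t)).support := by
    refine ae_all_iff.2 fun i => ae_all_iff.2 fun t => ?_
    have hid : IdentDistrib (X i t) (X 0 t) P P :=
      (hpanel.identDistrib_X i).comp (measurable_pi_apply t)
    refine ae_of_ae_map (hpanel.measurable_X i t).aemeasurable ?_
    rw [hid.map_eq]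
    exact Measure.support_mem_ae
  have hbad : Negligible P (fun n ω => ∃ s t j, (s < t ∧ (j = s ∨ j = t)) ∧ ENNReal.ofReal δ ≤
      ⨆ (x ∈ (P.map (X 0 s)).support) (y ∈ (P.map (X 0 t)).support),
        ‖phat n ω s t j x y - p s t j x y‖ₑ) :=
    .exists fun s => .exists fun t => .exists fun j => .and_left fun hj =>
      h s t hj.1 j hj.2 _ (ENNReal.ofReal_pos.2 hδ)
  refine ((negligible_of_ae hsupp).or hbad).mono fun n ω => ?_
  contrapose!
  rintro ⟨hs, hb⟩ s t hst i j hj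
  have hlt := hb s t j ⟨hst, hj⟩
  have hle : ‖phat n ω s t j (X i s ω) (X i t ω) - p s t j (X i s ω) (X i t ω)‖ₑ ≤
      ENNReal.ofReal δ :=
    (lt_of_le_of_lt (le_iSup₂_of_le (X i s ω) (hs i s) (le_iSup₂
      (f := fun y (_ : y ∈ (P.map (X 0 t)).support) =>
        ‖phat n ω s t j (X i s ω) y - p s t j (X i s ω) y‖ₑ) (X i t ω) (hs i t))) hlt).le
  rwa [← ofReal_norm, ENNReal.ofReal_le_ofReal_iff hδ.le] at hle

/-- Near a coefficient that violates a cyclic monotonicity inequality with positive probability,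
there is no minimizer of the criterion with probability approaching one. -/
lemma exists_nhds_negligible [IsProbabilityMeasure P] {β : Coef d} (hβ : β ≠ 0)
    (hpanel : IsPanel P A X ε) (hp : IsChoiceProb P (X 0) (Y 0) p)
    (hphat : UniformlyConsistent P (X 0) p phat) (hX : ∀ t, Integrable (X 0 t) P)
    (hYb : ∀ t k ω, |Y 0 t ω k| ≤ 1)
    (hnn : ∀ s t, ∀ᵐ ω ∂P, 0 ≤ ⟪β, cycleVector P (X 0) (Y 0) s t ω⟫)
    {βtilde : ℕ → Ω → Coef d}
    (hmin : ∀ n ω, IsMinOn (criterion X phat n ω) (maxSphere d) (βtilde n ω))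
    {b : Coef d} {s t : Fin T} (hst : s < t)
    (hneg : 0 < P {ω | ⟪b, cycleVector P (X 0) (Y 0) s t ω⟫ < 0}) :
    ∃ U ∈ 𝓝 b, Negligible P (fun n ω => βtilde n ω ∈ U) := by
  have hXm := hpanel.measurable_X 0
  have hCm : ∀ {s t : Fin T}, s < t → Measurable (cycleOf p s t) := fun hst =>
    measurable_cycleOf fun j hj => (hp _ _ hst j hj).1
  have hCi := integrable_cycleOf hp hXm hX hYb hst
  have hfm : Measurable fun x => negPart ⟪b, cycleOf p s t x⟫ :=
    continuous_negPart.measurable.comp (measurable_const.inner (hCm hst))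
  have hfi : Integrable (fun ω => negPart ⟪b, cycleOf p s t fun r => X 0 r ω⟫) P := by
    refine (hCi.const_inner (𝕜 := ℝ) b).norm.mono
      (hfm.comp (measurable_pi_lambda _ hXm)).aestronglyMeasurable (ae_of_all _ fun ω => ?_)
    rw [norm_norm, Real.norm_of_nonneg (negPart_nonneg _)]
    simpa [negPart_of_nonneg] using negPart_le_add ⟪b, cycleOf p s t fun r => X 0 r ω⟫ 0
  set η := ∫ ω, negPart ⟪b, cycleOf p s t fun r => X 0 r ω⟫ ∂P with hη
  have hη0 : 0 < η := by
    rw [hη, integral_pos_iff_support_of_nonneg (fun ω => negPart_nonneg _) hfi]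
    refine hneg.trans_le (measure_mono_ae ?_)
    filter_upwards [cycleOf_ae_eq_cycleVector hp hst] with ω h1 h2
    change ⟪b, cycleVector P (X 0) (Y 0) s t ω⟫ < 0 at h2
    rw [← h1] at h2
    change negPart _ ≠ 0
    rw [negPart_of_neg h2]
    linarith
  obtain ⟨r₀, hr₀, hb₀⟩ := exists_smul_mem_maxSphere hβ
  -- The feasible competitor to which the minimizer is compared.
  set b₀ := r₀ • β with hb₀'
  -- Bounds the sample means of `change` and of the cycle norm once each is within `1` of its
  -- expectation.
  set M : ℝ := 1 + ((∑ q : Fin T × Fin T, ∫ ω, change q.1 q.2 (fun r => X 0 r ω) ∂P)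
    + ∫ ω, ‖cycleOf p s t fun r => X 0 r ω‖ ∂P) with hM
  have hW0 : ∀ q : Fin T × Fin T, 0 ≤ ∫ ω, change q.1 q.2 (fun r => X 0 r ω) ∂P := fun q =>
    integral_nonneg fun ω => change_nonneg _ _ _
  have hC0 : 0 ≤ ∫ ω, ‖cycleOf p s t fun r => X 0 r ω‖ ∂P :=
    integral_nonneg fun ω => norm_nonneg _
  have hWM : ∀ s t, ∫ ω, change s t (fun r => X 0 r ω) ∂P + 1 ≤ M := fun s t => by
    have := Finset.single_le_sum (fun q _ => hW0 q) (Finset.mem_univ (s, t))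
    simp only at this
    linarith
  have hCM : ∫ ω, ‖cycleOf p s t fun r => X 0 r ω‖ ∂P + 1 ≤ M := by
    have := Finset.sum_nonneg fun q (_ : q ∈ Finset.univ) => hW0 q
    linarith
  have hM0 : 0 < M := by linarith
  set R := ‖b‖ + 1 + ‖b₀‖ with hR
  have hR0 : 0 < R := by positivity
  -- Since `R` bounds `‖βtilde n ω‖ + ‖b₀‖` on the ball, the estimation errors total at most `2 * δ
  -- * R * M = η / 8`; the radius `r` keeps the coefficient error below another `η / 8`.
  set δ := η / (16 * M * R) with hδ
  have hδ0 : 0 < δ := by positivity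
  set r := min 1 (η / (8 * M)) with hr
  have hr0 : 0 < r := by positivity
  have hae : ∀ᵐ ω ∂P, ∀ s t, s < t → ∀ i, 0 ≤ ⟪b₀, cycleOf p s t fun r => X i r ω⟫ := by
    refine ae_all_iff.2 fun s => ae_all_iff.2 fun t => ?_
    by_cases hst : s < t
    · have hms : MeasurableSet {x | 0 ≤ ⟪b₀, cycleOf p s t x⟫} :=
        measurableSet_le measurable_const (measurable_const.inner (hCm hst))
      have := hpanel.ae_forall (q := fun x => 0 ≤ ⟪b₀, cycleOf p s t x⟫) hms (by
        filter_upwards [hnn s t, cycleOf_ae_eq_cycleVector hp hst] with ω h1 h2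
        rw [h2, hb₀', inner_smul_left]
        exact mul_nonneg hr₀.le h1)
      filter_upwards [this] with ω hω _ using hω
    · exact ae_of_all _ fun ω h => absurd h hst
  have hWn : Negligible P (fun n ω => ∃ s t, 1 ≤ |sampleMean X (change s t) n ω
      - ∫ ω, change s t (fun r => X 0 r ω) ∂P|) :=
    .exists fun s => .exists fun t => hpanel.negligible_sampleMean (measurable_change s t)
      (integrable_change hX s t) one_pos
  have hCn := hpanel.negligible_sampleMean (hCm hst).norm hCi.norm one_pos
  have hfn := hpanel.negligible_sampleMean hfm hfi (half_pos hη0)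
  refine ⟨Metric.ball b r, Metric.ball_mem_nhds b hr0, ((hWn.or hCn).or
    (hfn.or ((hphat.negligible hpanel hδ0).or (negligible_of_ae hae)))).mono fun n ω hU => ?_⟩
  by_contra! hgood
  obtain ⟨⟨hW, hC⟩, hf, hest, hpos⟩ := hgood
  have hW' : ∀ s t, sampleMean X (change s t) n ω ≤ M := fun s t => by
    linarith [(abs_lt.1 (hW s t)).2, hWM s t]
  have hC' : sampleMean X (fun x => ‖cycleOf p s t x‖) n ω ≤ M := by
    linarith [(abs_lt.1 hC).2]
  have hf' := (abs_lt.1 hf).1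
  rw [Metric.mem_ball, dist_eq_norm, norm_sub_rev] at hU
  have hnorm : ‖βtilde n ω‖ ≤ ‖b‖ + 1 := by
    have := norm_le_norm_add_norm_sub b (βtilde n ω)
    linarith [min_le_left 1 (η / (8 * M))]
  have h1 := sampleMean_negPart_le (n := n) (hest s t hst) b (βtilde n ω)
  have h2 := sampleMean_le_criterion X phat n ω (βtilde n ω) hst
  have h3 : criterion X phat n ω (βtilde n ω) ≤ criterion X phat n ω b₀ := hmin n ω hb₀
  have h4 := criterion_le ⟨s, t, hst⟩ hδ0.le hest hW' hpos
  have h5 : ‖b - βtilde n ω‖ * sampleMean X (fun x => ‖cycleOf p s t x‖) n ω ≤ η / 8 := by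
    calc _ ≤ η / (8 * M) * M := by
          have := sampleMean_nonneg (X := X) (fun x => norm_nonneg (cycleOf p s t x)) n ω
          gcongr
          exact hU.le.trans (min_le_right _ _)
      _ = η / 8 := by field_simp
  have h6 : ‖βtilde n ω‖ * (2 * δ) * sampleMean X (change s t) n ω
      ≤ (‖b‖ + 1) * (2 * δ) * M := by
    have := sampleMean_nonneg (X := X) (change_nonneg s t) n ω
    gcongr
    exact hW' s t
  have h7 : (‖b‖ + 1) * (2 * δ) * M + ‖b₀‖ * (2 * δ) * M = η / 8 := by
    rw [← add_mul, ← add_mul, ← hR, hδ]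
    field_simp
    norm_num
  -- The sample mean at `b` exceeds `η / 2`, but `h1` to `h7` bound it by `η / 4`.
  linarith

end Consistency

end PanelChoice

theorem theorem4p1 {Ω : Type*} [MeasurableSpace Ω] (P : Measure Ω) [IsProbabilityMeasure P]
    {d K T : ℕ} (β : PanelChoice.Coef d) (hβ : ‖β‖ = 1)
    (A : ℕ → Ω → Fin K → ℝ) (X : ℕ → Fin T → Ω → PanelChoice.Cov d K)
    (ε : ℕ → Fin T → Ω → Fin K → ℝ)
    (hpanel : PanelChoice.IsPanel P A X ε)
    -- the choices generated by the model
    (Y : ℕ → Fin T → Ω → Fin K → ℝ)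
    (hY : ∀ i t ω, Y i t ω = PanelChoice.choice β (X i t ω) (A i ω) (ε i t ω))
    (herror : PanelChoice.ErrorAssumption P β (A 0) (X 0) (ε 0))
    (hcc : PanelChoice.IsHalfSpace (PanelChoice.cc (PanelChoice.cycleSet P (X 0) (Y 0))))
    -- the conditional choice probabilities and their estimators
    (p : Fin T → Fin T → Fin T → PanelChoice.Cov d K → PanelChoice.Cov d K → Fin K → ℝ)
    (hp : PanelChoice.IsChoiceProb P (X 0) (Y 0) p)
    (phat : ℕ → Ω → Fin T → Fin T → Fin T →
      PanelChoice.Cov d K → PanelChoice.Cov d K → Fin K → ℝ)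
    (hphat : PanelChoice.UniformlyConsistent P (X 0) p phat)
    (hX : ∀ t, Integrable (X 0 t) P)
    -- a minimizer of the criterion over the max-norm sphere, for every sample
    (βtilde : ℕ → Ω → PanelChoice.Coef d)
    (hmem : ∀ n ω, βtilde n ω ∈ PanelChoice.maxSphere d)
    (hmin : ∀ n ω, IsMinOn (PanelChoice.criterion X phat n ω) (PanelChoice.maxSphere d)
      (βtilde n ω)) :
    TendstoInMeasure P (fun n ω => ‖βtilde n ω‖⁻¹ • βtilde n ω) atTop (fun _ => β) := by
  have hβ0 : β ≠ 0 := by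
    rintro rfl
    simp at hβ
  have hnn : ∀ s t, ∀ᵐ ω ∂P, 0 ≤ ⟪β, PanelChoice.cycleVector P (X 0) (Y 0) s t ω⟫ :=
    PanelChoice.inner_cycleVector_nonneg (hpanel.measurable_A 0) (hpanel.measurable_X 0)
      (hpanel.measurable_ε 0) herror (hpanel.stationary 0) hX (hY 0)
  have hYb : ∀ t k ω, |Y 0 t ω k| ≤ 1 := fun t k ω => by
    rw [hY]
    exact PanelChoice.norm_choice_le _ _ _ _ k
  intro e he
  have key : PanelChoice.Negligible P fun n ω => βtilde n ω ∈ PanelChoice.maxSphere d ∧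
      e ≤ edist (‖βtilde n ω‖⁻¹ • βtilde n ω) β := by
    -- Negligibility passes to subsets and finite unions, so by compactness it need only hold near
    -- each point `b`. In the direction of `β`, continuity of normalization keeps the error below
    -- `e`; elsewhere minimizers are excluded.
    refine PanelChoice.isCompact_maxSphere.induction_on
      (p := fun S => PanelChoice.Negligible P fun n ω => βtilde n ω ∈ S ∧
        e ≤ edist (‖βtilde n ω‖⁻¹ • βtilde n ω) β)
      (PanelChoice.negligible_false.mono fun n ω h => h.1)
      (fun S S' hS h => h.mono fun n ω h => ⟨hS h.1, h.2⟩)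
      (fun S S' h h' => (h.or h').mono fun n ω h => h.1.imp (⟨·, h.2⟩) (⟨·, h.2⟩))
      fun b hb => ?_
    have hb0 := PanelChoice.ne_zero_of_mem_maxSphere hb
    by_cases hbβ : ‖b‖⁻¹ • b = β
    · have hcont : ContinuousAt (fun b' : PanelChoice.Coef d => edist (‖b'‖⁻¹ • b') β) b :=
        ((continuousAt_id.norm.inv₀ (norm_ne_zero_iff.2 hb0)).smul continuousAt_id).edist
          continuousAt_const
      have hlt : ∀ᶠ b' in 𝓝 b, edist (‖b'‖⁻¹ • b') β < e :=
        hcont.eventually_lt_const (by simpa [hbβ] using he)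
      exact ⟨_, mem_nhdsWithin_of_mem_nhds hlt,
        PanelChoice.negligible_false.mono fun n ω h => h.2.not_gt h.1⟩
    · obtain ⟨s, t, hst, hneg⟩ := PanelChoice.exists_inner_cycleVector_neg hβ
        (hpanel.measurable_X 0) hcc hnn hb0 hbβ
      obtain ⟨U, hU, hneg⟩ := PanelChoice.exists_nhds_negligible hβ0 hpanel hp hphat hX hYb hnn
        hmin hst hneg
      exact ⟨U, mem_nhdsWithin_of_mem_nhds hU, hneg.mono fun n ω h => h.1⟩
  exact key.mono fun n ω h => ⟨hmem n ω, h⟩
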